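/- Let $K$ be a field, $e\in\{0,2,3,4,\dots\}$, $I=\mathbb Z/e\mathbb Z$, and let $\Gamma_e$ be the quiver with vertex set $I$ and edges $i\to i+1$ ($i\in I$), with simple roots $\alpha_i$, simple coroots $\alpha_i^\vee$ and fundamental weights $\Lambda_i$, so that $\langle\Lambda_j,\alpha_i^\vee\rangle=\delta_{ij}$. Put $P^+=\bigoplus_{i\in I}\mathbb N\Lambda_i$, ordered by $\Lambda'\le\Lambda$ if $\Lambda-\Lambda'\in P^+$. Let $n\in\mathbb N$, let $\beta\in\bigoplus_{i\in I}\mathbb N\alpha_i$ have height $n$, and let $I^\beta=\{\mathbf i=(i_1,\dots,i_n)\in I^n : \alpha_{i_1}+\dots+\alpha_{i_n}=\beta\}$, on which $s_r$ acts by exchanging the $r$-th and $(r+1)$-st entries. Let $\mathscr R_\beta$ be the quiver Hecke algebra: the unital associative $K$-algebra with generators $\psi_1,\dots,\psi_{n-1}$, $y_1,\dots,y_n$, $e(\mathbf i)$ ($\mathbf i\in I^\beta$) and the following relations, for all $\mathbf i,\mathbf j\in I^\beta$ and all admissible $r,s$: \[ e(\mathbf i)e(\mathbf j)=\delta_{\mathbf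 i\mathbf j}e(\mathbf i),\quad \sum_{\mathbf i\in I^\beta}e(\mathbf i)=1,\quad y_re(\mathbf i)=e(\mathbf i)y_r,\quad \psi_re(\mathbf i)=e(s_r\mathbf i)\psi_r,\quad y_ry_s=y_sy_r, \] \[ \psi_ry_{r+1}e(\mathbf i)=(y_r\psi_r+\delta_{i_ri_{r+1}})e(\mathbf i),\qquad y_{r+1}\psi_re(\mathbf i)=(\psi_ry_r+\delta_{i_ri_{r+1}})e(\mathbf i), \] \[ \psi_ry_s=y_s\psi_r\ (s\ne r,r+1),\qquad \psi_r\psi_s=\psi_s\psi_r\ (|r-s|>1), \] \[ \psi_r^2e(\mathbf i)=\begin{cases}0&\text{if } i_r=i_{r+1},\\ (y_{r+1}-y_r)e(\mathbf i)&\text{if } i_r\to i_{r+1},\\ (y_r-y_{r+1})e(\mathbf i)&\text{if } i_r\leftarrow i_{r+1},\\ (y_{r+1}-y_r)(y_r-y_{r+1})e(\mathbf i)&\text{if } i_r\rightleftarrows i_{r+1},\\ e(\mathbf i)&\text{otherwise,}\end{cases} \] \[ \psi_r\psi_{r+1}\psi_re(\mathbf i)=\begin{cases}(\psi_{r+1}\psi_r\psi_{r+1}+1)e(\mathbf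 i)&\text{if } i_r=i_{r+2}\to i_{r+1},\\ (\psi_{r+1}\psi_r\psi_{r+1}-1)e(\mathbf i)&\text{if } i_r=i_{r+2}\leftarrow i_{r+1},\\ (\psi_{r+1}\psi_r\psi_{r+1}+y_r-2y_{r+1}+y_{r+2})e(\mathbf i)&\text{if } i_r=i_{r+2}\rightleftarrows i_{r+1},\\ \psi_{r+1}\psi_r\psi_{r+1}e(\mathbf i)&\text{otherwise.}\end{cases} \] Here $\rightleftarrows$ means that there are edges in both directions (this happens only for $e=2$), and $\to$, $\leftarrow$ mean that there is an edge in the indicated direction only. For $\Lambda\in P^+$ let $I(\Lambda)$ be the two-sided ideal of $\mathscr R_\beta$ generated by the elements $y_1^{\langle\Lambda,\alpha_{i_1}^\vee\rangle}e(\mathbf i)$, $\mathbf i\in I^\beta$ (for $n=0$ there are no such elements and $I(\Lambda)=0$), and let $\mathscr R_\beta^\Lambda=\mathscr R_\beta/I(\Lambda)$ be the cyclotomic quiver Hecke algebra. Then \[ \bigcap_{\Lambda\in P^+}I(\Lambda)=\{0\}. \] Consequently the canonical $K$-algebra homomorphism $\mathscr R_\beta\to\varprojlim_{\Lambda\in P^+}\mathscr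 R_\beta^\Lambda$, $x\mapsto(x+I(\Lambda))_\Lambda$, is injective, where the inverse limit is taken along the canonical surjections $\mathscr R_\beta^\Lambda\to\mathscr R_\beta^{\Lambda'}$ for $\Lambda'\le\Lambda$. -/

import Mathlib

namespace QuiverHecke

/-- The positive root lattice `Q⁺ = ⨁_{i ∈ I} ℕ α_i`, where `I = ℤ/eℤ` (so `I = ℤ` if `e = 0`):
`β i` is the coefficient of the simple root `α_i` in `β`. The height of `β` is `β.degree`. -/
abbrev PosRoot (e : ℕ) : Type := ZMod e →₀ ℕ

/-- The simple root `α_i`. -/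
noncomputable def simpleRoot {e : ℕ} (i : ZMod e) : PosRoot e := Finsupp.single i 1

/-- The dominant weight lattice `P⁺ = ⨁_{i ∈ I} ℕ Λ_i`: `Λ i` is the coefficient of the fundamental
weight `Λ_i` in `Λ`. The order is the pointwise one, i.e. `Λ' ≤ Λ` iff `Λ - Λ' ∈ P⁺`. -/
abbrev DominantWeight (e : ℕ) : Type := ZMod e →₀ ℕ

/-- The pairing `⟨Λ, α_i^∨⟩`; it is determined by `⟨Λ_j, α_i^∨⟩ = δ_{ij}`, so it is the coefficient
of `Λ_i` in `Λ`. -/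
def DominantWeight.pairing {e : ℕ} (Λ : DominantWeight e) (i : ZMod e) : ℕ := Λ i

/-- There is an edge `i → j` in the quiver `Γ_e`. -/
def Arrow {e : ℕ} (i j : ZMod e) : Prop := j = i + 1

/-- `I^β`, the set of all sequences `(i_1, …, i_n) ∈ I^n` with `α_{i_1} + ⋯ + α_{i_n} = β`.
Positions are numbered `0, …, n - 1` instead of `1, …, n`. -/
def ResidueSeq {e : ℕ} (n : ℕ) (β : PosRoot e) : Type :=
  {i : Fin n → ZMod e // ∑ k, simpleRoot (i k) = β}

instance {e n : ℕ} {β : PosRoot e} : CoeFun (ResidueSeq n β) (fun _ => Fin n → ZMod e) :=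
  ⟨Subtype.val⟩

theorem ResidueSeq.mem_support {e n : ℕ} {β : PosRoot e} (i : ResidueSeq n β) (k : Fin n) :
    i k ∈ β.support := by
  have hs : (∑ k, simpleRoot (i k)) (i k) = β (i k) := congrArg (fun γ : PosRoot e => γ (i k)) i.2
  rw [Finsupp.mem_support_iff, ← hs, Finsupp.finsetSum_apply]
  intro h
  have := (Finset.sum_eq_zero_iff.mp h) k (Finset.mem_univ k)
  simp [simpleRoot] at this

instance {e n : ℕ} {β : PosRoot e} : Finite (ResidueSeq n β) := by
  refine Finite.of_injective
    (fun (i : ResidueSeq n β) (k : Fin n) => (⟨i k, i.mem_support k⟩ : β.support)) ?_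
  intro i j h
  apply Subtype.ext
  funext k
  exact congrArg Subtype.val (congrFun h k)

noncomputable instance {e n : ℕ} {β : PosRoot e} : Fintype (ResidueSeq n β) := Fintype.ofFinite _

/-- The sequence obtained from `i` by exchanging the entries at the positions `a` and `b`. -/
def ResidueSeq.swap {e n : ℕ} {β : PosRoot e} (a b : Fin n) (i : ResidueSeq n β) :
    ResidueSeq n β :=
  ⟨fun k => i (Equiv.swap a b k),
    (Equiv.sum_comp (Equiv.swap a b) (fun k => simpleRoot (i k))).trans i.2⟩

/-- The generators of the quiver Hecke algebra. With positions numbered from `0`, the generator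
`psi r` exchanges the positions `r` and `r + 1`. -/
inductive Gen {e : ℕ} (n : ℕ) (β : PosRoot e) : Type
  | psi (r : ℕ) (hr : r + 1 < n) : Gen n β
  | y (k : Fin n) : Gen n β
  | idem (i : ResidueSeq n β) : Gen n β

section FreeGenerators

variable (K : Type*) [Field K] {e n : ℕ} {β : PosRoot e}

/-- The free generator `ψ_r`. -/
def fpsi (r : ℕ) (hr : r + 1 < n) : FreeAlgebra K (Gen n β) := FreeAlgebra.ι K (Gen.psi r hr)

/-- The free generator `y_k`. -/
def fy (k : Fin n) : FreeAlgebra K (Gen n β) := FreeAlgebra.ι K (Gen.y k)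

/-- The free generator `e(i)`. -/
def fe (i : ResidueSeq n β) : FreeAlgebra K (Gen n β) := FreeAlgebra.ι K (Gen.idem i)

end FreeGenerators

/-- The defining relations of the quiver Hecke algebra `R_β` of type `Γ_e`. -/
inductive Rel (K : Type*) [Field K] {e : ℕ} (n : ℕ) (β : PosRoot e) :
    FreeAlgebra K (Gen n β) → FreeAlgebra K (Gen n β) → Prop
  | idem_mul_self (i : ResidueSeq n β) : Rel K n β (fe K i * fe K i) (fe K i)
  | idem_mul_of_ne (i j : ResidueSeq n β) (h : i ≠ j) : Rel K n β (fe K i * fe K j) 0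
  | sum_idem : Rel K n β (∑ i : ResidueSeq n β, fe K i) 1
  | y_idem (k : Fin n) (i : ResidueSeq n β) : Rel K n β (fy K k * fe K i) (fe K i * fy K k)
  | psi_idem (r : ℕ) (hr : r + 1 < n) (i : ResidueSeq n β) :
      Rel K n β (fpsi K r hr * fe K i)
        (fe K (i.swap ⟨r, by omega⟩ ⟨r + 1, hr⟩) * fpsi K r hr)
  | y_comm (k l : Fin n) : Rel K n β (fy K k * fy K l) (fy K l * fy K k)
  | psi_y_succ (r : ℕ) (hr : r + 1 < n) (i : ResidueSeq n β) :
      Rel K n β (fpsi K r hr * fy K ⟨r + 1, hr⟩ * fe K i)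
        ((fy K ⟨r, by omega⟩ * fpsi K r hr
          + (if i ⟨r, by omega⟩ = i ⟨r + 1, hr⟩ then 1 else 0)) * fe K i)
  | y_succ_psi (r : ℕ) (hr : r + 1 < n) (i : ResidueSeq n β) :
      Rel K n β (fy K ⟨r + 1, hr⟩ * fpsi K r hr * fe K i)
        ((fpsi K r hr * fy K ⟨r, by omega⟩
          + (if i ⟨r, by omega⟩ = i ⟨r + 1, hr⟩ then 1 else 0)) * fe K i)
  | psi_y_comm (r : ℕ) (hr : r + 1 < n) (s : Fin n) (h : (s : ℕ) ≠ r) (h' : (s : ℕ) ≠ r + 1) :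
      Rel K n β (fpsi K r hr * fy K s) (fy K s * fpsi K r hr)
  | psi_comm (r s : ℕ) (hr : r + 1 < n) (hs : s + 1 < n) (h : r + 1 < s ∨ s + 1 < r) :
      Rel K n β (fpsi K r hr * fpsi K s hs) (fpsi K s hs * fpsi K r hr)
  -- `ψ_r² e(i)` in the five cases: equal, `→`, `←`, `⇄`, otherwise
  | psi_sq_eq (r : ℕ) (hr : r + 1 < n) (i : ResidueSeq n β)
      (h : i ⟨r, by omega⟩ = i ⟨r + 1, hr⟩) :
      Rel K n β (fpsi K r hr * fpsi K r hr * fe K i) 0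
  | psi_sq_right (r : ℕ) (hr : r + 1 < n) (i : ResidueSeq n β)
      (h : Arrow (i ⟨r, by omega⟩) (i ⟨r + 1, hr⟩))
      (h' : ¬ Arrow (i ⟨r + 1, hr⟩) (i ⟨r, by omega⟩)) :
      Rel K n β (fpsi K r hr * fpsi K r hr * fe K i)
        ((fy K ⟨r + 1, hr⟩ - fy K ⟨r, by omega⟩) * fe K i)
  | psi_sq_left (r : ℕ) (hr : r + 1 < n) (i : ResidueSeq n β)
      (h : ¬ Arrow (i ⟨r, by omega⟩) (i ⟨r + 1, hr⟩))
      (h' : Arrow (i ⟨r + 1, hr⟩) (i ⟨r, by omega⟩)) :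
      Rel K n β (fpsi K r hr * fpsi K r hr * fe K i)
        ((fy K ⟨r, by omega⟩ - fy K ⟨r + 1, hr⟩) * fe K i)
  | psi_sq_both (r : ℕ) (hr : r + 1 < n) (i : ResidueSeq n β)
      (h : Arrow (i ⟨r, by omega⟩) (i ⟨r + 1, hr⟩))
      (h' : Arrow (i ⟨r + 1, hr⟩) (i ⟨r, by omega⟩)) :
      Rel K n β (fpsi K r hr * fpsi K r hr * fe K i)
        ((fy K ⟨r + 1, hr⟩ - fy K ⟨r, by omega⟩) *
          (fy K ⟨r, by omega⟩ - fy K ⟨r + 1, hr⟩) * fe K i)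
  | psi_sq_far (r : ℕ) (hr : r + 1 < n) (i : ResidueSeq n β)
      (h₀ : i ⟨r, by omega⟩ ≠ i ⟨r + 1, hr⟩)
      (h : ¬ Arrow (i ⟨r, by omega⟩) (i ⟨r + 1, hr⟩))
      (h' : ¬ Arrow (i ⟨r + 1, hr⟩) (i ⟨r, by omega⟩)) :
      Rel K n β (fpsi K r hr * fpsi K r hr * fe K i) (fe K i)
  -- `ψ_r ψ_{r+1} ψ_r e(i)` in the four cases: `i_r = i_{r+2}` and `→`, `←`, `⇄`, otherwise
  | braid_right (r : ℕ) (hr : r + 2 < n) (i : ResidueSeq n β)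
      (h₀ : i ⟨r, by omega⟩ = i ⟨r + 2, hr⟩)
      (h : Arrow (i ⟨r, by omega⟩) (i ⟨r + 1, by omega⟩))
      (h' : ¬ Arrow (i ⟨r + 1, by omega⟩) (i ⟨r, by omega⟩)) :
      Rel K n β (fpsi K r (by omega) * fpsi K (r + 1) hr * fpsi K r (by omega) * fe K i)
        ((fpsi K (r + 1) hr * fpsi K r (by omega) * fpsi K (r + 1) hr + 1) * fe K i)
  | braid_left (r : ℕ) (hr : r + 2 < n) (i : ResidueSeq n β)
      (h₀ : i ⟨r, by omega⟩ = i ⟨r + 2, hr⟩)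
      (h : ¬ Arrow (i ⟨r, by omega⟩) (i ⟨r + 1, by omega⟩))
      (h' : Arrow (i ⟨r + 1, by omega⟩) (i ⟨r, by omega⟩)) :
      Rel K n β (fpsi K r (by omega) * fpsi K (r + 1) hr * fpsi K r (by omega) * fe K i)
        ((fpsi K (r + 1) hr * fpsi K r (by omega) * fpsi K (r + 1) hr - 1) * fe K i)
  | braid_both (r : ℕ) (hr : r + 2 < n) (i : ResidueSeq n β)
      (h₀ : i ⟨r, by omega⟩ = i ⟨r + 2, hr⟩)
      (h : Arrow (i ⟨r, by omega⟩) (i ⟨r + 1, by omega⟩))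
      (h' : Arrow (i ⟨r + 1, by omega⟩) (i ⟨r, by omega⟩)) :
      Rel K n β (fpsi K r (by omega) * fpsi K (r + 1) hr * fpsi K r (by omega) * fe K i)
        ((fpsi K (r + 1) hr * fpsi K r (by omega) * fpsi K (r + 1) hr
          + fy K ⟨r, by omega⟩ - 2 * fy K ⟨r + 1, by omega⟩ + fy K ⟨r + 2, hr⟩) * fe K i)
  | braid_far (r : ℕ) (hr : r + 2 < n) (i : ResidueSeq n β)
      (h : ¬ (i ⟨r, by omega⟩ = i ⟨r + 2, hr⟩ ∧
        (Arrow (i ⟨r, by omega⟩) (i ⟨r + 1, by omega⟩) ∨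
          Arrow (i ⟨r + 1, by omega⟩) (i ⟨r, by omega⟩)))) :
      Rel K n β (fpsi K r (by omega) * fpsi K (r + 1) hr * fpsi K r (by omega) * fe K i)
        (fpsi K (r + 1) hr * fpsi K r (by omega) * fpsi K (r + 1) hr * fe K i)

/-- The quiver Hecke algebra `R_β` over `K`, given by generators and relations. -/
abbrev QHA (K : Type*) [Field K] {e : ℕ} (n : ℕ) (β : PosRoot e) : Type _ := RingQuot (Rel K n β)

section Algebra

variable (K : Type*) [Field K] {e n : ℕ} {β : PosRoot e}

/-- The element `ψ_r` of `R_β`. -/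
noncomputable def psi (r : ℕ) (hr : r + 1 < n) : QHA K n β :=
  RingQuot.mkAlgHom K (Rel K n β) (fpsi K r hr)

/-- The element `y_k` of `R_β`. -/
noncomputable def y (k : Fin n) : QHA K n β := RingQuot.mkAlgHom K (Rel K n β) (fy K k)

/-- The element `e(i)` of `R_β`. -/
noncomputable def idem (i : ResidueSeq n β) : QHA K n β :=
  RingQuot.mkAlgHom K (Rel K n β) (fe K i)

/-- `I(Λ)`, the two-sided ideal of `R_β` generated by the elements `y_1^{⟨Λ, α_{i_1}^∨⟩} e(i)`,
`i ∈ I^β`; the first position has the number `0` here. For `n = 0` there is no first position,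
hence no generator, and the ideal is zero. -/
noncomputable def cyclotomicIdeal (β : PosRoot e) (Λ : DominantWeight e) :
    TwoSidedIdeal (QHA K n β) :=
  TwoSidedIdeal.span {x | ∃ (h : 0 < n) (i : ResidueSeq n β),
    x = y K ⟨0, h⟩ ^ Λ.pairing (i ⟨0, h⟩) * idem K i}

theorem cyclotomicIdeal_anti (β : PosRoot e) {Λ Λ' : DominantWeight e} (h : Λ' ≤ Λ) :
    cyclotomicIdeal K (n := n) β Λ ≤ cyclotomicIdeal K (n := n) β Λ' := by
  refine TwoSidedIdeal.span_le.mpr ?_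
  rintro x ⟨h0, i, rfl⟩
  have hle : Λ'.pairing (i ⟨0, h0⟩) ≤ Λ.pairing (i ⟨0, h0⟩) := h _
  rw [← Nat.sub_add_cancel hle, pow_add, mul_assoc]
  exact TwoSidedIdeal.mul_mem_left _ _ _ (TwoSidedIdeal.subset_span ⟨h0, i, rfl⟩)

/-- The cyclotomic quiver Hecke algebra `R_β^Λ = R_β / I(Λ)`. -/
abbrev CyclotomicQHA (n : ℕ) (β : PosRoot e) (Λ : DominantWeight e) : Type _ :=
  (cyclotomicIdeal K (n := n) β Λ).ringCon.Quotient

/-- The canonical surjection `R_β → R_β^Λ`. -/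
noncomputable def proj (n : ℕ) (β : PosRoot e) (Λ : DominantWeight e) :
    QHA K n β →ₐ[K] CyclotomicQHA K n β Λ :=
  RingCon.mkₐ K (cyclotomicIdeal K (n := n) β Λ).ringCon

/-- The canonical surjection `R_β^Λ → R_β^{Λ'}` for `Λ' ≤ Λ`. -/
noncomputable def transition (n : ℕ) (β : PosRoot e) {Λ Λ' : DominantWeight e} (h : Λ' ≤ Λ) :
    CyclotomicQHA K n β Λ →ₐ[K] CyclotomicQHA K n β Λ' :=
  RingCon.factorₐ K (TwoSidedIdeal.ringCon_le_iff.mp (cyclotomicIdeal_anti K (n := n) β h))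

theorem transition_proj (n : ℕ) (β : PosRoot e) {Λ Λ' : DominantWeight e} (h : Λ' ≤ Λ)
    (x : QHA K n β) : transition K n β h (proj K n β Λ x) = proj K n β Λ' x := rfl

/-- The inverse limit of the algebras `R_β^Λ`, `Λ ∈ P⁺`, along the canonical surjections:
the algebra of all compatible families. -/
noncomputable def inverseLimit (n : ℕ) (β : PosRoot e) :
    Subalgebra K (∀ Λ : DominantWeight e, CyclotomicQHA K n β Λ) where
  carrier := {x | ∀ (Λ Λ' : DominantWeight e) (h : Λ' ≤ Λ), transition K n β h (x Λ) = x Λ'}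
  mul_mem' hx hx' Λ Λ' h := by simp [hx Λ Λ' h, hx' Λ Λ' h]
  add_mem' hx hx' Λ Λ' h := by simp [hx Λ Λ' h, hx' Λ Λ' h]
  algebraMap_mem' c Λ Λ' h := by simp [Pi.algebraMap_apply]

/-- The canonical homomorphism from `R_β` to the inverse limit of the algebras `R_β^Λ`,
`x ↦ (x + I(Λ))_Λ`. -/
noncomputable def toInverseLimit (n : ℕ) (β : PosRoot e) : QHA K n β →ₐ[K] inverseLimit K n β :=
  (AlgHom.pi (fun Λ : DominantWeight e => proj K n β Λ)).codRestrict (inverseLimit K n β)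
    (fun x _ _ h => transition_proj K n β h x)

end Algebra

end QuiverHecke

/-!
The algebra `R_β` is `ℤ`-graded: `e(i)` has degree `0`, `y_k` has degree `2`, and `ψ_r e(i)` has
degree `-2`, `0`, `1` or `2`, depending on `i_r` and `i_{r+1}`. If the degrees occurring in `R_β`
are at least `N`, and `Λ` has coefficient `M` at every residue in the support of `β`, then the
generators `y_1^M e(i)` of `I(Λ)` have degree `2M`, so `I(Λ)` lives in degrees at least `2M + 2N`.
As `M` grows, every homogeneous component of an element of the intersection of all `I(Λ)` vanishes.

The grading is encoded by a homomorphism `R_β → R_β[T, T⁻¹]` that sends a homogeneous element `x` of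
degree `d` to `x T^d` (`gradingHom`). It exists because the defining relations are homogeneous
(`lift_gradedGen_rel`), and it is injective because `T = 1` gives a left inverse.

The lower bound (`exists_forall_mem_degGE`) is the easy half of the basis theorem. Let `A` be the
subalgebra generated by the `y_k` and the `e(i)`, which has non-negative degrees. Modulo terms with
fewer factors `ψ`, the `ψ_r` satisfy the nil-Coxeter relations and move past `A`. Hence the algebra
`H_{m+1}` generated by `A` and `ψ_0, …, ψ_m` is the sum of the spaces `H_m ψ_m ψ_{m-1} ⋯ ψ_k`
(`parabolic_succ_le`), as for the cosets of a symmetric group in the next one. By induction on `m`,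
the degrees of `H_m` are bounded below, and `H_m` is everything for large `m`.
-/

namespace QuiverHecke

/-! ### Descending products -/

section DescendingProducts

variable {K R : Type*} [Field K] [Ring R] [Algebra K R]

/-- The product `ψ_m ψ_{m-1} ⋯ ψ_{m+1-j}` of `j` factors with descending indices. -/
def descProd (ψ : ℕ → R) (m : ℕ) : ℕ → R
  | 0 => 1
  | j + 1 => descProd ψ m j * ψ (m - j)

/-- The subalgebra generated by `A` and `ψ_0, …, ψ_{m-1}`. -/
def parabolic (A : Subalgebra K R) (ψ : ℕ → R) (m : ℕ) : Subalgebra K R :=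
  Algebra.adjoin K ((A : Set R) ∪ {x | ∃ r < m, x = ψ r})

/-- The sum of the subspaces `H · ψ_m ψ_{m-1} ⋯ ψ_{m+1-i}` for `i ≤ j`, where `H` is the subalgebra
generated by `A` and `ψ_0, …, ψ_{m-1}`. -/
def cosetSpan (A : Subalgebra K R) (ψ : ℕ → R) (m : ℕ) : ℕ → Submodule K R
  | 0 => Subalgebra.toSubmodule (parabolic A ψ m)
  | j + 1 => cosetSpan A ψ m j ⊔
      (Subalgebra.toSubmodule (parabolic A ψ m)).map (LinearMap.mulRight K (descProd ψ m (j + 1)))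

variable {A : Subalgebra K R} {ψ : ℕ → R} {m : ℕ}

theorem le_parabolic : A ≤ parabolic A ψ m := fun _ hx => Algebra.subset_adjoin (Or.inl hx)

theorem mem_parabolic {r : ℕ} (hr : r < m) : ψ r ∈ parabolic A ψ m :=
  Algebra.subset_adjoin (Or.inr ⟨r, hr, rfl⟩)

theorem parabolic_zero : parabolic A ψ 0 = A := by simp [parabolic, Algebra.adjoin_eq]

theorem mem_cosetSpan_succ {j : ℕ} {x : R} :
    x ∈ cosetSpan A ψ m (j + 1) ↔
      ∃ z ∈ cosetSpan A ψ m j, ∃ h ∈ parabolic A ψ m, z + h * descProd ψ m (j + 1) = x := by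
  simp [cosetSpan, Submodule.mem_sup]

theorem cosetSpan_mono : Monotone (cosetSpan A ψ m) :=
  monotone_nat_of_le_succ fun _ => le_sup_left

theorem mul_descProd_mem {h : R} (hh : h ∈ parabolic A ψ m) (j : ℕ) :
    h * descProd ψ m j ∈ cosetSpan A ψ m j := by
  cases j with
  | zero => simpa [descProd, cosetSpan] using hh
  | succ j => exact mem_cosetSpan_succ.2 ⟨0, zero_mem _, h, hh, zero_add _⟩

theorem descProd_mem (j : ℕ) : descProd ψ m j ∈ cosetSpan A ψ m j := by
  simpa using mul_descProd_mem (A := A) (ψ := ψ) (m := m) (one_mem _) j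

theorem mul_mem_cosetSpan {h x : R} (hh : h ∈ parabolic A ψ m) :
    ∀ {j : ℕ}, x ∈ cosetSpan A ψ m j → h * x ∈ cosetSpan A ψ m j
  | 0, hx => mul_mem (S := Subalgebra K R) hh hx
  | j + 1, hx => by
    obtain ⟨z, hz, g, hg, rfl⟩ := mem_cosetSpan_succ.1 hx
    exact mem_cosetSpan_succ.2
      ⟨h * z, mul_mem_cosetSpan hh hz, h * g, mul_mem hh hg, by rw [mul_add, mul_assoc]⟩

theorem descProd_comm (hfar : ∀ r s, r + 1 < s → ψ r * ψ s = ψ s * ψ r) {r : ℕ} :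
    ∀ {j : ℕ}, r + j < m → descProd ψ m j * ψ r = ψ r * descProd ψ m j
  | 0, _ => by simp [descProd]
  | j + 1, h => by
    rw [descProd, mul_assoc, ← hfar r (m - j) (by omega), ← mul_assoc,
      descProd_comm hfar (by omega), mul_assoc]

/-- Right multiplication by a generator that commutes with all factors of the descending
products. -/
theorem cosetSpan_mul_far (hfar : ∀ r s, r + 1 < s → ψ r * ψ s = ψ s * ψ r) {r : ℕ} {x : R} :
    ∀ {j : ℕ}, r + j < m → x ∈ cosetSpan A ψ m j → x * ψ r ∈ cosetSpan A ψ m j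
  | 0, h, hx => mul_mem (S := Subalgebra K R) hx (mem_parabolic (by omega))
  | j + 1, h, hx => by
    obtain ⟨z, hz, g, hg, rfl⟩ := mem_cosetSpan_succ.1 hx
    refine mem_cosetSpan_succ.2 ⟨z * ψ r, cosetSpan_mul_far hfar (by omega) hz, g * ψ r,
      mul_mem hg (mem_parabolic (by omega)), ?_⟩
    rw [add_mul, mul_assoc, mul_assoc, descProd_comm hfar h]

/-- Right multiplication by the generator `ψ_{m-j}`, which prolongs the longest descending
product. -/
theorem cosetSpan_mul_next (hfar : ∀ r s, r + 1 < s → ψ r * ψ s = ψ s * ψ r) {x : R} :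
    ∀ {j : ℕ}, j ≤ m → x ∈ cosetSpan A ψ m j → x * ψ (m - j) ∈ cosetSpan A ψ m (j + 1)
  | 0, _, hx => mem_cosetSpan_succ.2 ⟨0, zero_mem _, x, hx, by simp [descProd]⟩
  | j + 1, h, hx => by
    obtain ⟨z, hz, g, hg, rfl⟩ := mem_cosetSpan_succ.1 hx
    rw [add_mul, mul_assoc]
    exact add_mem (cosetSpan_mono (by omega) (cosetSpan_mul_far hfar (by omega) hz))
      (mul_descProd_mem hg (j + 2))

/-- The spans are stable under right multiplication by `A`. -/
theorem cosetSpan_mul_base (hfar : ∀ r s, r + 1 < s → ψ r * ψ s = ψ s * ψ r)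
    (hA : ∀ r, ∀ a ∈ A, ∃ b ∈ A, ∃ c ∈ A, ψ r * a = b * ψ r + c) :
    ∀ {j : ℕ}, j ≤ m + 1 → ∀ {x : R}, x ∈ cosetSpan A ψ m j → ∀ a ∈ A,
      x * a ∈ cosetSpan A ψ m j
  | 0, _, _, hx, _, ha => mul_mem (S := Subalgebra K R) hx (le_parabolic ha)
  | j + 1, hj, x, hx, a, ha => by
    obtain ⟨z, hz, g, hg, rfl⟩ := mem_cosetSpan_succ.1 hx
    obtain ⟨b, hb, c, hc, hbc⟩ := hA (m - j) a ha
    have ih := fun {x : R} => cosetSpan_mul_base hfar hA (j := j) (by omega) (x := x)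
    have hd := descProd_mem (A := A) (ψ := ψ) (m := m) j
    have key : descProd ψ m (j + 1) * a =
        descProd ψ m j * b * ψ (m - j) + descProd ψ m j * c := by
      rw [descProd, mul_assoc, hbc, mul_add, mul_assoc]
    rw [add_mul, mul_assoc, key]
    exact add_mem (cosetSpan_mono (by omega) (ih hz a ha))
      (mul_mem_cosetSpan hg (add_mem (cosetSpan_mul_next hfar (by omega) (ih hd b hb))
        (cosetSpan_mono (by omega) (ih hd c hc))))

/-- Right multiplication of a descending product by one of its own factors. If the factor is the
last one, the quadratic relation applies; otherwise it commutes past the factors after its successor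
in the product, and the braid relation applies. -/
theorem descProd_mul_mem (hfar : ∀ r s, r + 1 < s → ψ r * ψ s = ψ s * ψ r)
    (hA : ∀ r, ∀ a ∈ A, ∃ b ∈ A, ∃ c ∈ A, ψ r * a = b * ψ r + c)
    (hsq : ∀ r, ψ r * ψ r ∈ A)
    (hbraid : ∀ r, ψ (r + 1) * ψ r * ψ (r + 1) - ψ r * ψ (r + 1) * ψ r ∈ A) {t : ℕ} :
    ∀ {k : ℕ}, t + 1 + k ≤ m + 1 →
      descProd ψ m (t + 1 + k) * ψ (m - t) ∈ cosetSpan A ψ m (t + 1 + k)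
  | 0, hk => by
    rw [Nat.add_zero, descProd, mul_assoc]
    exact cosetSpan_mono (by omega)
      (cosetSpan_mul_base hfar hA (by omega) (descProd_mem t) _ (hsq _))
  | 1, hk => by
    -- `ψ_{r+1} ψ_r ψ_{r+1} = ψ_r ψ_{r+1} ψ_r + a`, and the first `ψ_r` moves to the far left.
    obtain ⟨r, hr⟩ : ∃ r, m - t = r + 1 := ⟨m - t - 1, by omega⟩
    have hr' : m - (t + 1) = r := by omega
    have key : descProd ψ m (t + 1 + 1) * ψ (m - t) = ψ r * descProd ψ m (t + 2) +
        descProd ψ m t * (ψ (r + 1) * ψ r * ψ (r + 1) - ψ r * ψ (r + 1) * ψ r) := by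
      simp only [descProd, hr, hr', ← mul_assoc, mul_sub]
      rw [descProd_comm hfar (r := r) (by omega)]
      abel
    rw [key]
    exact add_mem (mul_descProd_mem (mem_parabolic (by omega)) _) (cosetSpan_mono (by omega)
      (cosetSpan_mul_base hfar hA (by omega) (descProd_mem t) _ (hbraid r)))
  | k + 2, hk => by
    have ih := descProd_mul_mem hfar hA hsq hbraid (t := t) (k := k + 1) (by omega)
    have key : descProd ψ m (t + 1 + (k + 2)) * ψ (m - t) =
        descProd ψ m (t + 1 + (k + 1)) * ψ (m - t) * ψ (m - (t + 1 + (k + 1))) := by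
      rw [mul_assoc _ (ψ (m - t)), ← hfar (m - (t + 1 + (k + 1))) (m - t) (by omega), ← mul_assoc]
      rfl
    rw [key]
    exact cosetSpan_mul_next hfar (j := t + 1 + (k + 1)) (by omega) ih

/-- The full span is stable under right multiplication by `ψ_0, …, ψ_m`. -/
theorem cosetSpan_mul_gen (hfar : ∀ r s, r + 1 < s → ψ r * ψ s = ψ s * ψ r)
    (hA : ∀ r, ∀ a ∈ A, ∃ b ∈ A, ∃ c ∈ A, ψ r * a = b * ψ r + c)
    (hsq : ∀ r, ψ r * ψ r ∈ A)
    (hbraid : ∀ r, ψ (r + 1) * ψ r * ψ (r + 1) - ψ r * ψ (r + 1) * ψ r ∈ A)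
    {r : ℕ} (hr : r ≤ m) {x : R} :
    ∀ {j : ℕ}, j ≤ m + 1 → x ∈ cosetSpan A ψ m j → x * ψ r ∈ cosetSpan A ψ m (m + 1)
  | 0, hj, hx => by
    rcases hr.lt_or_eq with h | rfl
    · exact cosetSpan_mono (by omega) (cosetSpan_mul_far hfar (j := 0) h hx)
    · exact cosetSpan_mono (by omega) (cosetSpan_mul_next hfar (j := 0) (by omega) hx)
  | j + 1, hj, hx => by
    obtain ⟨z, hz, g, hg, rfl⟩ := mem_cosetSpan_succ.1 hx
    rw [add_mul, mul_assoc]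
    refine add_mem (cosetSpan_mul_gen hfar hA hsq hbraid hr (by omega) hz)
      (mul_mem_cosetSpan hg ?_)
    obtain h | h | h : r + (j + 1) < m ∨ r + (j + 1) = m ∨ m < r + (j + 1) := by omega
    · exact cosetSpan_mono hj (cosetSpan_mul_far hfar h (descProd_mem _))
    · obtain rfl : r = m - (j + 1) := by omega
      exact cosetSpan_mono (by omega) (cosetSpan_mul_next hfar (by omega) (descProd_mem _))
    · have := descProd_mul_mem (m := m) hfar hA hsq hbraid (t := m - r) (k := j - (m - r))
        (by omega)
      rw [show m - r + 1 + (j - (m - r)) = j + 1 by omega, show m - (m - r) = r by omega] at this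
      exact cosetSpan_mono hj this

/-- The analogue of the decomposition of `S_{m+2}` into cosets of `S_{m+1}`: each coset has a
representative `s_m s_{m-1} ⋯ s_k`. -/
theorem parabolic_succ_le (hfar : ∀ r s, r + 1 < s → ψ r * ψ s = ψ s * ψ r)
    (hA : ∀ r, ∀ a ∈ A, ∃ b ∈ A, ∃ c ∈ A, ψ r * a = b * ψ r + c)
    (hsq : ∀ r, ψ r * ψ r ∈ A)
    (hbraid : ∀ r, ψ (r + 1) * ψ r * ψ (r + 1) - ψ r * ψ (r + 1) * ψ r ∈ A) {x : R}
    (hx : x ∈ parabolic A ψ (m + 1)) : x ∈ cosetSpan A ψ m (m + 1) := by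
  suffices h : ∀ z ∈ cosetSpan A ψ m (m + 1), z * x ∈ cosetSpan A ψ m (m + 1) by
    simpa using h 1 (cosetSpan_mono (Nat.zero_le _) (descProd_mem 0))
  induction hx using Algebra.adjoin_induction with
  | mem x hx =>
    rcases hx with hx | ⟨r, hr, rfl⟩
    · exact fun z hz => cosetSpan_mul_base hfar hA le_rfl hz x hx
    · exact fun z hz => cosetSpan_mul_gen hfar hA hsq hbraid (by omega) le_rfl hz
  | algebraMap c =>
    intro z hz
    rw [← Algebra.commutes, ← Algebra.smul_def]
    exact Submodule.smul_mem _ c hz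
  | add x x' _ _ h h' => exact fun z hz => by rw [mul_add]; exact add_mem (h z hz) (h' z hz)
  | mul x x' _ _ h h' => exact fun z hz => by rw [← mul_assoc]; exact h' _ (h z hz)

/-- If the elements `ψ_r` of a filtered algebra satisfy the relations of a nil-Coxeter algebra up to
terms in a subalgebra `A` of non-negative degree, then the degrees occurring in the generated
algebra are bounded below. -/
theorem exists_parabolic_le (F : ℤ → Submodule K R) (hF : Antitone F)
    (hmul : ∀ {a b x z}, x ∈ F a → z ∈ F b → x * z ∈ F (a + b))
    (hAF : ∀ x ∈ A, x ∈ F 0) (hψ : ∀ r, ψ r ∈ F (-2))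
    (hfar : ∀ r s, r + 1 < s → ψ r * ψ s = ψ s * ψ r)
    (hA : ∀ r, ∀ a ∈ A, ∃ b ∈ A, ∃ c ∈ A, ψ r * a = b * ψ r + c)
    (hsq : ∀ r, ψ r * ψ r ∈ A)
    (hbraid : ∀ r, ψ (r + 1) * ψ r * ψ (r + 1) - ψ r * ψ (r + 1) * ψ r ∈ A) (m : ℕ) :
    ∃ N : ℤ, ∀ x ∈ parabolic A ψ m, x ∈ F N := by
  induction m with
  | zero => exact ⟨0, by simpa [parabolic_zero] using hAF⟩
  | succ m ih =>
    obtain ⟨N, hN⟩ := ih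
    have hdesc : ∀ j : ℕ, descProd ψ m j ∈ F (-2 * j) := by
      intro j
      induction j with
      | zero => exact hAF 1 (one_mem A)
      | succ j ih => exact hF (by push_cast; omega) (hmul ih (hψ (m - j)))
    have hspan : ∀ j : ℕ, ∀ x ∈ cosetSpan A ψ m j, x ∈ F (N - 2 * j) := by
      intro j
      induction j with
      | zero => exact fun x hx => hF (by simp) (hN x hx)
      | succ j ih =>
        intro x hx
        obtain ⟨z, hz, g, hg, rfl⟩ := mem_cosetSpan_succ.1 hx
        exact add_mem (hF (by push_cast; omega) (ih z hz))
          (hF (by push_cast; omega) (hmul (hN g hg) (hdesc (j + 1))))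
    exact ⟨_, fun x hx => hspan (m + 1) x (parabolic_succ_le hfar hA hsq hbraid hx)⟩

end DescendingProducts

/-! ### Relations in the quiver Hecke algebra -/

section Relations

variable {K : Type*} [Field K] {e n : ℕ} {β : PosRoot e}

theorem idem_mul_self (i : ResidueSeq n β) : idem K i * idem K i = idem K i := by
  simpa [idem] using RingQuot.mkAlgHom_rel K (Rel.idem_mul_self (K := K) i)

theorem idem_mul_of_ne {i j : ResidueSeq n β} (h : i ≠ j) : idem K i * idem K j = 0 := by
  simpa [idem] using RingQuot.mkAlgHom_rel K (Rel.idem_mul_of_ne (K := K) i j h)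

theorem sum_idem : ∑ i : ResidueSeq n β, idem K i = 1 := by
  simpa [idem] using RingQuot.mkAlgHom_rel K (Rel.sum_idem (K := K) (n := n) (β := β))

theorem y_idem (k : Fin n) (i : ResidueSeq n β) : y K k * idem K i = idem K i * y K k := by
  simpa [idem, y] using RingQuot.mkAlgHom_rel K (Rel.y_idem (K := K) k i)

theorem psi_idem (r : ℕ) (hr : r + 1 < n) (i : ResidueSeq n β) :
    psi K r hr * idem K i = idem K (i.swap ⟨r, by omega⟩ ⟨r + 1, hr⟩) * psi K r hr := by
  simpa [idem, psi] using RingQuot.mkAlgHom_rel K (Rel.psi_idem (K := K) r hr i)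

theorem psi_y_succ (r : ℕ) (hr : r + 1 < n) (i : ResidueSeq n β) :
    psi K r hr * y K ⟨r + 1, hr⟩ * idem K i =
      y K ⟨r, by omega⟩ * psi K r hr * idem K i +
        if i ⟨r, by omega⟩ = i ⟨r + 1, hr⟩ then idem K i else 0 := by
  have := RingQuot.mkAlgHom_rel K (Rel.psi_y_succ (K := K) r hr i)
  split_ifs at this ⊢ <;> simpa [idem, psi, y, add_mul] using this

theorem y_succ_psi (r : ℕ) (hr : r + 1 < n) (i : ResidueSeq n β) :
    y K ⟨r + 1, hr⟩ * psi K r hr * idem K i =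
      psi K r hr * y K ⟨r, by omega⟩ * idem K i +
        if i ⟨r, by omega⟩ = i ⟨r + 1, hr⟩ then idem K i else 0 := by
  have := RingQuot.mkAlgHom_rel K (Rel.y_succ_psi (K := K) r hr i)
  split_ifs at this ⊢ <;> simpa [idem, psi, y, add_mul] using this

theorem psi_y_comm (r : ℕ) (hr : r + 1 < n) (s : Fin n) (h : (s : ℕ) ≠ r) (h' : (s : ℕ) ≠ r + 1) :
    psi K (β := β) r hr * y K s = y K s * psi K r hr := by
  simpa [psi, y] using RingQuot.mkAlgHom_rel K (Rel.psi_y_comm (K := K) (β := β) r hr s h h')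

theorem psi_comm (r s : ℕ) (hr : r + 1 < n) (hs : s + 1 < n) (h : r + 1 < s ∨ s + 1 < r) :
    psi K (β := β) r hr * psi K s hs = psi K s hs * psi K r hr := by
  simpa [psi] using RingQuot.mkAlgHom_rel K (Rel.psi_comm (K := K) (β := β) r s hr hs h)

end Relations

/-! ### The subalgebra generated by the `y_k` and the `e(i)` -/

section Base

variable (K : Type*) [Field K] {e : ℕ} (n : ℕ) (β : PosRoot e)

/-- The subalgebra of `R_β` generated by all `y_k` and all `e(i)`. -/
noncomputable def polyPart : Subalgebra K (QHA K n β) :=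
  Algebra.adjoin K (Set.range (y K) ∪ Set.range (idem K))

/-- The generator `ψ_r`, with the convention `ψ_r = 0` if `r` is out of range; all relations that
bound degrees hold for the zero element too. -/
noncomputable def psiExt (r : ℕ) : QHA K n β := if hr : r + 1 < n then psi K r hr else 0

variable {K n β}

theorem psiExt_eq {r : ℕ} (hr : r + 1 < n) : psiExt K n β r = psi K r hr := dif_pos hr

theorem psiExt_eq_zero {r : ℕ} (hr : ¬ r + 1 < n) : psiExt K n β r = 0 := dif_neg hr

theorem y_mem_polyPart (k : Fin n) : y K k ∈ polyPart K n β :=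
  Algebra.subset_adjoin (Or.inl ⟨k, rfl⟩)

theorem idem_mem_polyPart (i : ResidueSeq n β) : idem K i ∈ polyPart K n β :=
  Algebra.subset_adjoin (Or.inr ⟨i, rfl⟩)

theorem mem_of_forall_mul_idem_mem {x : QHA K n β} (h : ∀ i, x * idem K i ∈ polyPart K n β) :
    x ∈ polyPart K n β := by
  rw [← mul_one x, ← sum_idem, Finset.mul_sum]
  exact sum_mem fun i _ => h i

theorem psi_sq_mem {r : ℕ} (hr : r + 1 < n) : psi K r hr * psi K r hr ∈ polyPart K n β := by
  refine mem_of_forall_mul_idem_mem fun i => ?_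
  have hy (k : Fin n) := y_mem_polyPart (K := K) (β := β) k
  have hi := idem_mem_polyPart (K := K) i
  by_cases h₀ : i ⟨r, by omega⟩ = i ⟨r + 1, hr⟩
  · have := RingQuot.mkAlgHom_rel K (Rel.psi_sq_eq (K := K) r hr i h₀)
    simp only [map_mul, map_zero] at this
    exact this ▸ zero_mem _
  by_cases h : Arrow (i ⟨r, by omega⟩) (i ⟨r + 1, hr⟩) <;>
    by_cases h' : Arrow (i ⟨r + 1, hr⟩) (i ⟨r, by omega⟩)
  · have := RingQuot.mkAlgHom_rel K (Rel.psi_sq_both (K := K) r hr i h h')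
    simp only [map_mul, map_sub] at this
    exact this ▸ mul_mem (mul_mem (sub_mem (hy _) (hy _)) (sub_mem (hy _) (hy _))) hi
  · have := RingQuot.mkAlgHom_rel K (Rel.psi_sq_right (K := K) r hr i h h')
    simp only [map_mul, map_sub] at this
    exact this ▸ mul_mem (sub_mem (hy _) (hy _)) hi
  · have := RingQuot.mkAlgHom_rel K (Rel.psi_sq_left (K := K) r hr i h h')
    simp only [map_mul, map_sub] at this
    exact this ▸ mul_mem (sub_mem (hy _) (hy _)) hi
  · have := RingQuot.mkAlgHom_rel K (Rel.psi_sq_far (K := K) r hr i h₀ h h')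
    simp only [map_mul] at this
    exact this ▸ hi

/-- The braid relation holds modulo the subalgebra generated by the `y_k` and the `e(i)`. -/
theorem psi_braid_mem {r : ℕ} (hr : r + 2 < n) :
    psi K r (by omega) * psi K (r + 1) hr * psi K r (by omega) -
      psi K (r + 1) hr * psi K r (by omega) * psi K (r + 1) hr ∈ polyPart K n β := by
  refine mem_of_forall_mul_idem_mem fun i => ?_
  have hy (k : Fin n) := y_mem_polyPart (K := K) (β := β) k
  have hi := idem_mem_polyPart (K := K) i
  rw [sub_mul]
  by_cases hfar : i ⟨r, by omega⟩ = i ⟨r + 2, hr⟩ ∧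
        (Arrow (i ⟨r, by omega⟩) (i ⟨r + 1, by omega⟩) ∨
          Arrow (i ⟨r + 1, by omega⟩) (i ⟨r, by omega⟩))
  · obtain ⟨h₀, -⟩ := id hfar
    by_cases h : Arrow (i ⟨r, by omega⟩) (i ⟨r + 1, by omega⟩) <;>
      by_cases h' : Arrow (i ⟨r + 1, by omega⟩) (i ⟨r, by omega⟩)
    · have := RingQuot.mkAlgHom_rel K (Rel.braid_both (K := K) r hr i h₀ h h')
      simp only [map_mul, map_sub, map_add, map_ofNat] at this
      have hmem : (y K ⟨r, by omega⟩ - 2 * y K ⟨r + 1, by omega⟩ + y K ⟨r + 2, hr⟩) * idem K i ∈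
          polyPart K n β :=
        mul_mem (add_mem (sub_mem (hy _) (mul_mem (ofNat_mem _ 2) (hy _))) (hy _)) hi
      convert hmem using 1
      rw [sub_eq_iff_eq_add', ← add_mul, ← add_assoc, ← add_sub_assoc]
      exact this
    · have := RingQuot.mkAlgHom_rel K (Rel.braid_right (K := K) r hr i h₀ h h')
      simp only [map_mul, map_add, add_mul, one_mul] at this
      exact sub_eq_iff_eq_add'.2 this ▸ hi
    · have := RingQuot.mkAlgHom_rel K (Rel.braid_left (K := K) r hr i h₀ h h')
      simp only [map_mul, map_sub, sub_mul, one_mul] at this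
      exact sub_eq_iff_eq_add'.2 (this.trans (sub_eq_add_neg _ _)) ▸ neg_mem hi
    · tauto
  · have := RingQuot.mkAlgHom_rel K (Rel.braid_far (K := K) r hr i hfar)
    simp only [map_mul] at this
    exact sub_eq_zero.2 this ▸ zero_mem _

/-- Elements of the subalgebra move through `ψ_r` up to terms without `ψ_r`. -/
theorem psi_mul_polyPart {r : ℕ} (hr : r + 1 < n) (a : QHA K n β) (ha : a ∈ polyPart K n β) :
    ∃ b ∈ polyPart K n β, ∃ c ∈ polyPart K n β, psi K r hr * a = b * psi K r hr + c := by
  have hy (k : Fin n) := y_mem_polyPart (K := K) (β := β) k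
  have hi (i : ResidueSeq n β) := idem_mem_polyPart (K := K) (β := β) i
  induction ha using Algebra.adjoin_induction with
  | mem x hx =>
    rcases hx with ⟨s, rfl⟩ | ⟨i, rfl⟩
    · by_cases h : (s : ℕ) = r
      · have hrn : r < n := by omega
        obtain rfl : s = ⟨r, hrn⟩ := Fin.ext h
        refine ⟨_, hy ⟨r + 1, hr⟩, psi K r hr * y K ⟨r, by omega⟩ - y K ⟨r + 1, hr⟩ * psi K r hr,
          mem_of_forall_mul_idem_mem fun i => ?_, by abel⟩
        rw [sub_mul, y_succ_psi]
        split_ifs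
        · simpa using neg_mem (hi i)
        · simp
      by_cases h' : (s : ℕ) = r + 1
      · obtain rfl : s = ⟨r + 1, hr⟩ := Fin.ext h'
        refine ⟨_, hy ⟨r, by omega⟩,
          psi K r hr * y K ⟨r + 1, hr⟩ - y K ⟨r, by omega⟩ * psi K r hr,
          mem_of_forall_mul_idem_mem fun i => ?_, by abel⟩
        rw [sub_mul, psi_y_succ]
        split_ifs
        · simpa using hi i
        · simp
      · exact ⟨_, hy s, 0, zero_mem _, by rw [psi_y_comm r hr s h h', add_zero]⟩
    · exact ⟨_, hi _, 0, zero_mem _, by rw [psi_idem, add_zero]⟩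
  | algebraMap c =>
    exact ⟨_, (polyPart K n β).algebraMap_mem c, 0, zero_mem _,
      by rw [add_zero, Algebra.commutes]⟩
  | add x x' _ _ h h' =>
    obtain ⟨b, hb, c, hc, h⟩ := h
    obtain ⟨b', hb', c', hc', h'⟩ := h'
    exact ⟨_, add_mem hb hb', _, add_mem hc hc', by rw [mul_add, h, h', add_mul]; abel⟩
  | mul x x' _ hx' h h' =>
    obtain ⟨b, hb, c, hc, h⟩ := h
    obtain ⟨b', hb', c', hc', h'⟩ := h'
    exact ⟨_, mul_mem hb hb', _, add_mem (mul_mem hb hc') (mul_mem hc hx'), by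
      rw [← mul_assoc, h, add_mul, mul_assoc, h', mul_add, mul_assoc, add_assoc]⟩

theorem parabolic_eq_top : parabolic (polyPart K n β) (psiExt K n β) n = ⊤ := by
  let T := parabolic (polyPart K n β) (psiExt K n β) n
  have hgen : ∀ g : Gen n β, RingQuot.mkAlgHom K (Rel K n β) (FreeAlgebra.ι K g) ∈ T := by
    rintro (⟨r, hr⟩ | k | i)
    · change psi K r hr ∈ T
      exact psiExt_eq (K := K) (β := β) hr ▸ mem_parabolic (by omega : r < n)
    · exact le_parabolic (y_mem_polyPart k)
    · exact le_parabolic (idem_mem_polyPart i)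
  refine eq_top_iff.2 fun x _ => ?_
  obtain ⟨x, rfl⟩ := RingQuot.mkAlgHom_surjective K (Rel K n β) x
  induction x using FreeAlgebra.induction with
  | grade0 c => simp
  | grade1 g => exact hgen g
  | mul a b ha hb => simpa using mul_mem (ha trivial) (hb trivial)
  | add a b ha hb => simpa using add_mem (ha trivial) (hb trivial)

/-- A filtration of `R_β` in which the `y_k` and the `e(i)` have non-negative degree and the `ψ_r`
have degree at least `-2` is bounded below. -/
theorem exists_forall_mem_of_filtration (F : ℤ → Submodule K (QHA K n β)) (hF : Antitone F)
    (hmul : ∀ {a b x z}, x ∈ F a → z ∈ F b → x * z ∈ F (a + b)) (hone : 1 ∈ F 0)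
    (hy : ∀ k, y K k ∈ F 0) (hi : ∀ i, idem K i ∈ F 0) (hψ : ∀ r hr, psi K r hr ∈ F (-2)) :
    ∃ N : ℤ, ∀ x, x ∈ F N := by
  have hA : ∀ x ∈ polyPart K n β, x ∈ F 0 := by
    intro x hx
    induction hx using Algebra.adjoin_induction with
    | mem x hx => rcases hx with ⟨k, rfl⟩ | ⟨i, rfl⟩ <;> simp [hy, hi]
    | algebraMap c =>
      exact Algebra.algebraMap_eq_smul_one (A := QHA K n β) c ▸ (F 0).smul_mem c hone
    | add x x' _ _ h h' => exact add_mem h h'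
    | mul x x' _ _ h h' => simpa using hmul h h'
  obtain ⟨N, hN⟩ := exists_parabolic_le (A := polyPart K n β) (ψ := psiExt K n β) F hF hmul hA
    (fun r => by
      by_cases hr : r + 1 < n
      · exact psiExt_eq (K := K) (β := β) hr ▸ hψ r hr
      · exact psiExt_eq_zero (K := K) (β := β) hr ▸ zero_mem _)
    (fun r s h => by
      by_cases hs : s + 1 < n
      · rw [psiExt_eq hs, psiExt_eq (r := r) (by omega), psi_comm _ _ _ _ (Or.inl h)]
      · simp [psiExt_eq_zero hs])
    (fun r a ha => by
      by_cases hr : r + 1 < n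
      · exact psiExt_eq (K := K) (β := β) hr ▸ psi_mul_polyPart hr a ha
      · exact ⟨0, zero_mem _, 0, zero_mem _, by simp [psiExt_eq_zero hr]⟩)
    (fun r => by
      by_cases hr : r + 1 < n
      · exact psiExt_eq (K := K) (β := β) hr ▸ psi_sq_mem hr
      · simp [psiExt_eq_zero hr])
    (fun r => by
      by_cases hr : r + 2 < n
      · rw [psiExt_eq (r := r + 1) hr, psiExt_eq (r := r) (by omega), ← neg_sub]
        exact neg_mem (psi_braid_mem hr)
      · simp [psiExt_eq_zero (r := r + 1) hr]) n
  exact ⟨N, fun x => hN x (parabolic_eq_top (K := K) (β := β) ▸ trivial)⟩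

end Base

/-! ### The grading -/

section Grading

open scoped Classical in
/-- The degree of `ψ_r e(i)`, where `a` and `b` are the entries of `i` at the positions `r` and
`r + 1`: minus the Cartan pairing of `α_a` and `α_b`. -/
noncomputable def crossDeg {e : ℕ} (a b : ZMod e) : ℤ :=
  if a = b then -2 else (if Arrow a b then 1 else 0) + if Arrow b a then 1 else 0

theorem crossDeg_comm {e : ℕ} (a b : ZMod e) : crossDeg a b = crossDeg b a := by
  simp only [crossDeg, eq_comm, add_comm]

theorem crossDeg_self {e : ℕ} (a : ZMod e) : crossDeg a a = -2 := by simp [crossDeg]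

theorem neg_two_le_crossDeg {e : ℕ} (a b : ZMod e) : -2 ≤ crossDeg a b := by
  unfold crossDeg
  split_ifs <;> norm_num

theorem not_arrow_self {e : ℕ} (he : e ≠ 1) (a : ZMod e) : ¬ Arrow a a := by
  have : Nontrivial (ZMod e) := ZMod.nontrivial_iff.2 he
  simp [Arrow]

theorem crossDeg_of_arrow {e : ℕ} (he : e ≠ 1) {a b : ZMod e} (h : Arrow a b ∨ Arrow b a) :
    crossDeg a b = (open scoped Classical in
      (if Arrow a b then 1 else 0) + if Arrow b a then 1 else 0) := by
  refine if_neg ?_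
  rintro rfl
  exact not_arrow_self he a (h.elim id id)

open AddMonoidAlgebra (single)

variable (K : Type*) [Field K] {e : ℕ} (n : ℕ) (β : PosRoot e)

/-- The ring `R_β[T, T⁻¹]`. -/
abbrev LaurentQHA : Type _ := AddMonoidAlgebra (QHA K n β) ℤ

variable {K n β}

theorem LaurentQHA.sub_mul (X Y Z : LaurentQHA K n β) : (X - Y) * Z = X * Z - Y * Z :=
  _root_.sub_mul X Y Z

theorem LaurentQHA.mul_sub (X Y Z : LaurentQHA K n β) : X * (Y - Z) = X * Y - X * Z :=
  _root_.mul_sub X Y Z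

/-- The degree of `ψ_r e(i)`, in terms of the sequence `i`. -/
noncomputable def psiDeg (r : ℕ) (hr : r + 1 < n) (i : ResidueSeq n β) : ℤ :=
  crossDeg (i ⟨r, by omega⟩) (i ⟨r + 1, hr⟩)

variable (K) in
/-- The element `∑_i ψ_r e(i) T^{deg ψ_r e(i)}`. -/
noncomputable def gradedPsi (r : ℕ) (hr : r + 1 < n) : LaurentQHA K n β :=
  ∑ i : ResidueSeq n β, single (psiDeg r hr i) (psi K r hr * idem K i)

variable (K n β) in
/-- The map that multiplies each homogeneous generator of degree `d` by `T^d`. -/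
noncomputable def gradedGen : Gen n β → LaurentQHA K n β
  | .psi r hr => gradedPsi K r hr
  | .y k => single 2 (y K k)
  | .idem i => single 0 (idem K i)

/-- If `x` starts with `e(i)`, then only the summand of index `i` acts on `x T^d`. -/
theorem gradedPsi_mul_single {r : ℕ} (hr : r + 1 < n) {i : ResidueSeq n β} {d : ℤ} {x : QHA K n β}
    (hx : idem K i * x = x) :
    gradedPsi K r hr * single d x = single (psiDeg r hr i + d) (psi K r hr * x) := by
  rw [gradedPsi, Finset.sum_mul, Finset.sum_eq_single i]
  · rw [AddMonoidAlgebra.single_mul_single, mul_assoc, hx]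
  · intro j _ hj
    rw [AddMonoidAlgebra.single_mul_single, mul_assoc, ← hx, ← mul_assoc (idem K j),
      idem_mul_of_ne hj]
    simp
  · simp

theorem idem_mul_psi {r : ℕ} (hr : r + 1 < n) {i : ResidueSeq n β} {x : QHA K n β}
    (hx : idem K i * x = x) :
    idem K (i.swap ⟨r, by omega⟩ ⟨r + 1, hr⟩) * (psi K r hr * x) = psi K r hr * x := by
  rw [← mul_assoc, ← psi_idem, mul_assoc, hx]

theorem idem_mul_y (k : Fin n) {i : ResidueSeq n β} {x : QHA K n β}
    (hx : idem K i * x = x) : idem K i * (y K k * x) = y K k * x := by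
  rw [← mul_assoc, ← y_idem, mul_assoc, hx]

theorem sum_single_idem : ∑ i : ResidueSeq n β, single 0 (idem K i) = (1 : LaurentQHA K n β) := by
  rw [AddMonoidAlgebra.one_def, ← sum_idem]
  exact (map_sum (AddMonoidAlgebra.singleAddHom (0 : ℤ)) _ _).symm

/-- An identity can be checked after multiplication by each `e(i)`. -/
theorem eq_of_forall_mul_idem {X Y : LaurentQHA K n β}
    (h : ∀ i, X * single 0 (idem K i) = Y * single 0 (idem K i)) : X = Y := by
  rw [← mul_one X, ← mul_one Y, ← sum_single_idem, Finset.mul_sum, Finset.mul_sum]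
  exact Finset.sum_congr rfl fun i _ => h i

theorem swap_apply_of_ne {a b k : Fin n} (i : ResidueSeq n β) (ha : k ≠ a) (hb : k ≠ b) :
    i.swap a b k = i k :=
  congrArg i.1 (Equiv.swap_apply_of_ne_of_ne ha hb)

theorem swap_apply_left (a b : Fin n) (i : ResidueSeq n β) : i.swap a b a = i b :=
  congrArg i.1 (Equiv.swap_apply_left a b)

theorem swap_apply_right (a b : Fin n) (i : ResidueSeq n β) : i.swap a b b = i a :=
  congrArg i.1 (Equiv.swap_apply_right a b)

theorem psiDeg_swap_self {r : ℕ} (hr : r + 1 < n) (i : ResidueSeq n β) :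
    psiDeg r hr (i.swap ⟨r, by omega⟩ ⟨r + 1, hr⟩) = psiDeg r hr i := by
  rw [psiDeg, swap_apply_left, swap_apply_right, crossDeg_comm, psiDeg]

theorem psiDeg_swap_far {r s : ℕ} (hr : r + 1 < n) (hs : s + 1 < n) (h : r + 1 < s ∨ s + 1 < r)
    (i : ResidueSeq n β) :
    psiDeg r hr (i.swap ⟨s, by omega⟩ ⟨s + 1, hs⟩) = psiDeg r hr i := by
  rw [psiDeg, swap_apply_of_ne, swap_apply_of_ne, psiDeg] <;> simp [Fin.ext_iff] <;> omega

theorem gradedPsi_sq_mul {r : ℕ} (hr : r + 1 < n) (i : ResidueSeq n β) :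
    gradedPsi K r hr * gradedPsi K r hr * single 0 (idem K i) =
      single (2 * psiDeg r hr i) (psi K r hr * psi K r hr * idem K i) := by
  rw [mul_assoc, gradedPsi_mul_single hr (idem_mul_self i),
    gradedPsi_mul_single hr (idem_mul_psi hr (idem_mul_self i)), psiDeg_swap_self, mul_assoc]
  congr 1
  ring

/-- The sum of the degrees of the three crossings in a braid on the strands `r`, `r + 1`,
`r + 2`. -/
noncomputable def braidDeg (r : ℕ) (hr : r + 2 < n) (i : ResidueSeq n β) : ℤ :=
  crossDeg (i ⟨r, by omega⟩) (i ⟨r + 1, by omega⟩) + crossDeg (i ⟨r, by omega⟩) (i ⟨r + 2, hr⟩) +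
    crossDeg (i ⟨r + 1, by omega⟩) (i ⟨r + 2, hr⟩)

theorem gradedPsi_braid_left_mul {r : ℕ} (hr : r + 2 < n) (i : ResidueSeq n β) :
    gradedPsi K r (by omega) * gradedPsi K (r + 1) hr * gradedPsi K r (by omega) *
      single 0 (idem K i) = single (braidDeg r hr i)
        (psi K r (by omega) * psi K (r + 1) hr * psi K r (by omega) * idem K i) := by
  have h13 : (⟨r, by omega⟩ : Fin n) ≠ ⟨r + 2, hr⟩ := by simp [Fin.ext_iff]
  have h12 : (⟨r, by omega⟩ : Fin n) ≠ ⟨r + 1, by omega⟩ := by simp [Fin.ext_iff]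
  have h23 : (⟨r + 1, by omega⟩ : Fin n) ≠ ⟨r + 2, hr⟩ := by simp [Fin.ext_iff]
  have h1 := idem_mul_psi (K := K) (r := r) (by omega) (idem_mul_self i)
  have h2 := idem_mul_psi (r := r + 1) hr h1
  rw [mul_assoc, mul_assoc, gradedPsi_mul_single _ (idem_mul_self i), gradedPsi_mul_single _ h1,
    gradedPsi_mul_single _ h2]
  congr 1
  · simp only [psiDeg, braidDeg, swap_apply_left, swap_apply_right, swap_apply_of_ne _ h12 h13,
      swap_apply_of_ne _ h13.symm h23.symm]
    ring
  · simp only [mul_assoc]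

theorem gradedPsi_braid_right_mul {r : ℕ} (hr : r + 2 < n) (i : ResidueSeq n β) :
    gradedPsi K (r + 1) hr * gradedPsi K r (by omega) * gradedPsi K (r + 1) hr *
      single 0 (idem K i) = single (braidDeg r hr i)
        (psi K (r + 1) hr * psi K r (by omega) * psi K (r + 1) hr * idem K i) := by
  have h13 : (⟨r, by omega⟩ : Fin n) ≠ ⟨r + 2, hr⟩ := by simp [Fin.ext_iff]
  have h12 : (⟨r, by omega⟩ : Fin n) ≠ ⟨r + 1, by omega⟩ := by simp [Fin.ext_iff]
  have h23 : (⟨r + 1, by omega⟩ : Fin n) ≠ ⟨r + 2, hr⟩ := by simp [Fin.ext_iff]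
  have h1 := idem_mul_psi (K := K) (r := r + 1) hr (idem_mul_self i)
  have h2 := idem_mul_psi (r := r) (by omega) h1
  rw [mul_assoc, mul_assoc, gradedPsi_mul_single _ (idem_mul_self i), gradedPsi_mul_single _ h1,
    gradedPsi_mul_single _ h2]
  congr 1
  · simp only [psiDeg, braidDeg, swap_apply_left, swap_apply_right, swap_apply_of_ne _ h12 h13,
      swap_apply_of_ne _ h13.symm h23.symm]
    ring
  · simp only [mul_assoc]

/-- The defining relations are homogeneous. The hypothesis `e ≠ 1` excludes loops in the quiver;
with a loop, the relation `ψ_r² e(i) = (y_{r+1} - y_r)(y_r - y_{r+1}) e(i)` would also apply to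
`i_r = i_{r+1}`, where `ψ_r² e(i)` has degree `-4`. -/
theorem lift_gradedGen_rel (he : e ≠ 1) {a b : FreeAlgebra K (Gen n β)} (h : Rel K n β a b) :
    FreeAlgebra.lift K (gradedGen K n β) a = FreeAlgebra.lift K (gradedGen K n β) b := by
  have hq := RingQuot.mkAlgHom_rel K h
  have hpsi (r : ℕ) (hr : r + 1 < n) :
      FreeAlgebra.lift K (gradedGen K n β) (fpsi K r hr) = gradedPsi K r hr := by
    simp [fpsi, gradedGen]
  have hy (k : Fin n) : FreeAlgebra.lift K (gradedGen K n β) (fy K k) = single 2 (y K k) := by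
    simp [fy, gradedGen]
  have hi (i : ResidueSeq n β) :
      FreeAlgebra.lift K (gradedGen K n β) (fe K i) = single 0 (idem K i) := by
    simp [fe, gradedGen]
  have mpsi (r : ℕ) (hr : r + 1 < n) :
      RingQuot.mkAlgHom K (Rel K n β) (fpsi K r hr) = psi K r hr := rfl
  have my (k : Fin n) : RingQuot.mkAlgHom K (Rel K n β) (fy K k) = y K k := rfl
  have mi (i : ResidueSeq n β) : RingQuot.mkAlgHom K (Rel K n β) (fe K i) = idem K i := rfl
  cases h <;>
    simp only [map_mul, map_add, map_sub, map_zero, map_one, map_sum, map_ofNat, hpsi, hy, hi, mpsi,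
      my, mi] at hq ⊢
  case idem_mul_self i => rw [AddMonoidAlgebra.single_mul_single, hq, add_zero]
  case idem_mul_of_ne i j h =>
    rw [AddMonoidAlgebra.single_mul_single, hq, AddMonoidAlgebra.single_zero]
  case sum_idem => exact sum_single_idem
  case y_idem k i =>
    rw [AddMonoidAlgebra.single_mul_single, hq, AddMonoidAlgebra.single_mul_single, add_comm]
  case psi_idem r hr i =>
    rw [gradedPsi_mul_single hr (idem_mul_self i), gradedPsi, Finset.mul_sum,
      Finset.sum_eq_single i]
    · rw [AddMonoidAlgebra.single_mul_single, ← mul_assoc, ← hq, mul_assoc, idem_mul_self]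
      simp
    · intro j _ hj
      rw [AddMonoidAlgebra.single_mul_single, ← mul_assoc, ← hq, mul_assoc, idem_mul_of_ne hj.symm]
      simp
    · simp
  case y_comm k l =>
    rw [AddMonoidAlgebra.single_mul_single, hq, AddMonoidAlgebra.single_mul_single]
  case psi_y_succ r hr i =>
    rw [mul_assoc, AddMonoidAlgebra.single_mul_single,
      gradedPsi_mul_single hr (idem_mul_y _ (idem_mul_self i)), add_mul, mul_assoc (single _ _),
      gradedPsi_mul_single hr (idem_mul_self i), AddMonoidAlgebra.single_mul_single,
      ← mul_assoc, hq]
    split_ifs with h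
    · rw [psiDeg, h, crossDeg_self]
      simp [add_mul, mul_assoc]
    · simp [mul_assoc, add_comm]
  case y_succ_psi r hr i =>
    rw [mul_assoc, gradedPsi_mul_single hr (idem_mul_self i), AddMonoidAlgebra.single_mul_single,
      add_mul, mul_assoc (gradedPsi K r hr), AddMonoidAlgebra.single_mul_single,
      gradedPsi_mul_single hr (idem_mul_y _ (idem_mul_self i)), ← mul_assoc, hq]
    split_ifs with h
    · rw [psiDeg, h, crossDeg_self]
      simp [add_mul, mul_assoc]
    · simp [mul_assoc, add_comm]
  case psi_y_comm r hr s h h' =>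
    refine eq_of_forall_mul_idem fun i => ?_
    rw [mul_assoc, AddMonoidAlgebra.single_mul_single,
      gradedPsi_mul_single hr (idem_mul_y _ (idem_mul_self i)), mul_assoc,
      gradedPsi_mul_single hr (idem_mul_self i), AddMonoidAlgebra.single_mul_single,
      ← mul_assoc, hq, mul_assoc]
    congr 1
    ring
  case psi_comm r s hr hs h =>
    refine eq_of_forall_mul_idem fun i => ?_
    rw [mul_assoc, gradedPsi_mul_single hs (idem_mul_self i),
      gradedPsi_mul_single hr (idem_mul_psi hs (idem_mul_self i)), mul_assoc,
      gradedPsi_mul_single hr (idem_mul_self i),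
      gradedPsi_mul_single hs (idem_mul_psi hr (idem_mul_self i)), ← mul_assoc, hq, mul_assoc,
      psiDeg_swap_far hr hs h, psiDeg_swap_far hs hr h.symm]
    congr 1
    ring
  case psi_sq_eq r hr i h => rw [gradedPsi_sq_mul, hq, AddMonoidAlgebra.single_zero]
  case psi_sq_right r hr i h h' =>
    rw [gradedPsi_sq_mul, hq, psiDeg, crossDeg_of_arrow he (Or.inl h)]
    simp only [h, h', if_true, if_false, sub_mul, LaurentQHA.sub_mul, AddMonoidAlgebra.single_sub,
      AddMonoidAlgebra.single_mul_single]
    norm_num only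
  case psi_sq_left r hr i h h' =>
    rw [gradedPsi_sq_mul, hq, psiDeg, crossDeg_of_arrow he (Or.inr h')]
    simp only [h, h', if_true, if_false, sub_mul, LaurentQHA.sub_mul, AddMonoidAlgebra.single_sub,
      AddMonoidAlgebra.single_mul_single]
    norm_num only
  case psi_sq_both r hr i h h' =>
    rw [gradedPsi_sq_mul, hq, psiDeg, crossDeg_of_arrow he (Or.inl h)]
    simp only [h, h', if_true, sub_mul, mul_sub, LaurentQHA.sub_mul, LaurentQHA.mul_sub,
      AddMonoidAlgebra.single_sub, AddMonoidAlgebra.single_mul_single]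
    norm_num only
  case psi_sq_far r hr i h₀ h h' =>
    rw [gradedPsi_sq_mul, hq, psiDeg, crossDeg]
    simp [h₀, h, h']
  case braid_right r hr i h₀ h h' =>
    rw [gradedPsi_braid_left_mul, hq, add_mul, add_mul, gradedPsi_braid_right_mul,
      braidDeg, ← h₀, crossDeg_self, crossDeg_comm (i ⟨r + 1, _⟩), crossDeg_of_arrow he (Or.inl h)]
    simp only [h, h', if_true, if_false, one_mul, AddMonoidAlgebra.single_add]
    norm_num only
  case braid_left r hr i h₀ h h' =>
    rw [gradedPsi_braid_left_mul, hq, sub_mul, LaurentQHA.sub_mul, gradedPsi_braid_right_mul,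
      braidDeg, ← h₀, crossDeg_self, crossDeg_comm (i ⟨r + 1, _⟩), crossDeg_of_arrow he (Or.inr h')]
    simp only [h, h', if_true, if_false, one_mul, AddMonoidAlgebra.single_sub]
    norm_num only
  case braid_both r hr i h₀ h h' =>
    simp only [gradedPsi_braid_left_mul, hq, add_mul, sub_mul, LaurentQHA.sub_mul,
      gradedPsi_braid_right_mul]
    rw [braidDeg, ← h₀, crossDeg_self, crossDeg_comm (i ⟨r + 1, _⟩),
      crossDeg_of_arrow he (Or.inl h)]
    simp only [h, h', if_true, two_mul, add_mul, AddMonoidAlgebra.single_add,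
      AddMonoidAlgebra.single_sub, AddMonoidAlgebra.single_mul_single]
    norm_num only
  case braid_far r hr i h =>
    rw [gradedPsi_braid_left_mul, hq, gradedPsi_braid_right_mul]

variable (K n β) in
/-- The homomorphism `R_β → R_β[T, T⁻¹]` that sends a homogeneous element `x` of degree `d` to
`x T^d`. It encodes the grading of `R_β`. -/
noncomputable def gradingHom (he : e ≠ 1) : QHA K n β →ₐ[K] LaurentQHA K n β :=
  RingQuot.liftAlgHom K ⟨FreeAlgebra.lift K (gradedGen K n β), fun _ _ => lift_gradedGen_rel he⟩

theorem gradingHom_mk (he : e ≠ 1) (g : Gen n β) :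
    gradingHom K n β he (RingQuot.mkAlgHom K (Rel K n β) (FreeAlgebra.ι K g)) =
      gradedGen K n β g := by
  simp [gradingHom]

/-- Setting `T = 1` gives a left inverse of the grading homomorphism. -/
theorem gradingHom_injective (he : e ≠ 1) : Function.Injective (gradingHom K n β he) := by
  let ε : LaurentQHA K n β →ₐ[K] QHA K n β :=
    AddMonoidAlgebra.liftNCAlgHom (AlgHom.id K _) 1 fun _ _ => Commute.one_right _
  have hε (d : ℤ) (x : QHA K n β) : ε (single d x) = x := by
    exact (AddMonoidAlgebra.liftNC_single _ _ _ _).trans (mul_one x)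
  have h : ε.comp (gradingHom K n β he) = AlgHom.id K _ := by
    refine RingQuot.ringQuot_ext' _ _ _ (FreeAlgebra.hom_ext (funext fun g => ?_))
    refine (congrArg ε (gradingHom_mk he g)).trans ?_
    change _ = RingQuot.mkAlgHom K (Rel K n β) _
    rcases g with ⟨r, hr⟩ | k | i
    · simp only [gradedGen, gradedPsi, map_sum, hε]
      rw [← Finset.mul_sum, sum_idem, mul_one]
      rfl
    · exact hε _ _
    · exact hε _ _
  exact Function.LeftInverse.injective (g := ε) (DFunLike.congr_fun h)

variable (K n β) in
/-- The subspace of the elements of `R_β` whose homogeneous components of degree less than `d`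
vanish. -/
noncomputable def degGE (he : e ≠ 1) (d : ℤ) : Submodule K (QHA K n β) where
  carrier := {x | ∀ k < d, (gradingHom K n β he x).coeff k = 0}
  zero_mem' k _ := by simp
  add_mem' hx hz k hk := by simp [hx k hk, hz k hk]
  smul_mem' c x hx k hk := by simp [hx k hk]

theorem degGE_antitone (he : e ≠ 1) : Antitone (degGE K n β he) :=
  fun _ _ hd _ hx k hk => hx k (hk.trans_le hd)

theorem mem_degGE_of_eq_single {he : e ≠ 1} {d : ℤ} {x z : QHA K n β}
    (h : gradingHom K n β he x = single d z) : x ∈ degGE K n β he d := by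
  intro k hk
  rw [h, AddMonoidAlgebra.coeff_single, Finsupp.single_eq_of_ne hk.ne]

theorem mul_mem_degGE {he : e ≠ 1} {a b : ℤ} {x z : QHA K n β} (hx : x ∈ degGE K n β he a)
    (hz : z ∈ degGE K n β he b) : x * z ∈ degGE K n β he (a + b) := by
  classical
  intro k hk
  rw [map_mul, AddMonoidAlgebra.coeff_mul]
  refine Finset.sum_eq_zero fun p _ => Finset.sum_eq_zero fun q _ => ?_
  dsimp only
  split_ifs with h
  · obtain h' | h' : p < a ∨ q < b := by omega
    · rw [hx p h', zero_mul]
    · rw [hz q h', mul_zero]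
  · rfl

theorem eq_zero_of_forall_mem_degGE (he : e ≠ 1) {x : QHA K n β}
    (h : ∀ d, x ∈ degGE K n β he d) : x = 0 := by
  refine gradingHom_injective he ?_
  rw [map_zero]
  ext k
  simpa using h (k + 1) k (by omega)

theorem gradingHom_y (he : e ≠ 1) (k : Fin n) :
    gradingHom K n β he (y K k) = single 2 (y K k) := gradingHom_mk he _

theorem gradingHom_idem (he : e ≠ 1) (i : ResidueSeq n β) :
    gradingHom K n β he (idem K i) = single 0 (idem K i) := gradingHom_mk he _

theorem psi_mem_degGE (he : e ≠ 1) (r : ℕ) (hr : r + 1 < n) :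
    psi K r hr ∈ degGE K n β he (-2) := by
  intro k hk
  rw [show gradingHom K n β he (psi K r hr) = gradedPsi K r hr from gradingHom_mk he _, gradedPsi,
    AddMonoidAlgebra.coeff_sum, Finsupp.finsetSum_apply]
  refine Finset.sum_eq_zero fun i _ => ?_
  rw [AddMonoidAlgebra.coeff_single, Finsupp.single_eq_of_ne]
  exact (hk.trans_le (neg_two_le_crossDeg _ _)).ne

variable (K n β) in
/-- The degrees occurring in `R_β` are bounded below. -/
theorem exists_forall_mem_degGE (he : e ≠ 1) : ∃ N : ℤ, ∀ x, x ∈ degGE K n β he N :=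
  exists_forall_mem_of_filtration (degGE K n β he) (degGE_antitone he) mul_mem_degGE
    (mem_degGE_of_eq_single (z := 1) (by rw [map_one]; rfl))
    (fun k => degGE_antitone he (by norm_num) (mem_degGE_of_eq_single (gradingHom_y he k)))
    (fun i => mem_degGE_of_eq_single (gradingHom_idem he i)) (psi_mem_degGE he)

end Grading

/-! ### Cyclotomic ideals -/

section Cyclotomic

variable {K : Type*} [Field K] {e n : ℕ} {β : PosRoot e}

/-- The subspace of elements of degree at least `d` is not an ideal, so the bound is needed for all
two-sided multiples of the generators. -/
theorem mem_degGE_of_mem_span (he : e ≠ 1) {d : ℤ} {s : Set (QHA K n β)}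
    (hs : ∀ x ∈ s, ∀ a b, a * x * b ∈ degGE K n β he d) {x : QHA K n β}
    (hx : x ∈ TwoSidedIdeal.span s) : x ∈ degGE K n β he d := by
  let J : TwoSidedIdeal (QHA K n β) := .mk' {x | ∀ a b, a * x * b ∈ degGE K n β he d}
    (by simp) (fun h h' a b => by rw [mul_add, add_mul]; exact add_mem (h a b) (h' a b))
    (fun {u} h a b => by
      have h' : a * -u * b = -(a * u * b) := (congrArg (· * b) (mul_neg a u)).trans (neg_mul _ b)
      exact h' ▸ neg_mem (h a b))
    (fun {u v} h a b => by simpa [mul_assoc] using h (a * u) b)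
    (fun {u v} h a b => by simpa [mul_assoc] using h a (v * b))
  have hJ : x ∈ J := TwoSidedIdeal.span_le.2
    (fun z hz => (TwoSidedIdeal.mem_mk' ..).2 (hs z hz)) hx
  simpa using (TwoSidedIdeal.mem_mk' ..).1 hJ 1 1

theorem gradingHom_y_pow_mul_idem (he : e ≠ 1) (k : Fin n) (m : ℕ) (i : ResidueSeq n β) :
    gradingHom K n β he (y K k ^ m * idem K i) =
      AddMonoidAlgebra.single (2 * m : ℤ) (y K k ^ m * idem K i) := by
  rw [map_mul, map_pow, gradingHom_y, gradingHom_idem, AddMonoidAlgebra.single_pow,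
    AddMonoidAlgebra.single_mul_single]
  congr 1
  simp [mul_comm]

variable (K n β) in
/-- Cyclotomic ideals of large weights live in large degrees. -/
theorem exists_cyclotomicIdeal_le_degGE (he : e ≠ 1) (d : ℤ) :
    ∃ Λ : DominantWeight e, ∀ x ∈ cyclotomicIdeal K (n := n) β Λ, x ∈ degGE K n β he d := by
  obtain ⟨N, hN⟩ := exists_forall_mem_degGE K n β he
  let M : ℕ := (d - 2 * N).toNat
  -- Only the residues in the support of `β` occur, so finitely many coefficients suffice.
  refine ⟨Finsupp.indicator β.support fun _ _ => M, fun x hx => mem_degGE_of_mem_span he ?_ hx⟩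
  rintro _ ⟨h0, i, rfl⟩ a b
  have hM : DominantWeight.pairing (Finsupp.indicator β.support fun _ _ => M) (i ⟨0, h0⟩) = M := by
    rw [DominantWeight.pairing, Finsupp.indicator_of_mem (i.mem_support _)]
  rw [hM]
  exact degGE_antitone he (by omega) (mul_mem_degGE (mul_mem_degGE (hN a)
    (mem_degGE_of_eq_single (gradingHom_y_pow_mul_idem he ⟨0, h0⟩ M i))) (hN b))

end Cyclotomic

end QuiverHecke

theorem lemma4p4 (K : Type*) [Field K] (e : ℕ) (he : e ≠ 1) (n : ℕ) (β : QuiverHecke.PosRoot e)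
    (hβ : β.degree = n) :
    (⨅ Λ : QuiverHecke.DominantWeight e, QuiverHecke.cyclotomicIdeal K (n := n) β Λ) = ⊥ ∧
      Function.Injective (QuiverHecke.toInverseLimit K n β) := by
  have key : ∀ x : QuiverHecke.QHA K n β,
      (∀ Λ, x ∈ QuiverHecke.cyclotomicIdeal K (n := n) β Λ) → x = 0 := fun x hx =>
    QuiverHecke.eq_zero_of_forall_mem_degGE he fun d =>
      let ⟨Λ, hΛ⟩ := QuiverHecke.exists_cyclotomicIdeal_le_degGE K n β he d
      hΛ x (hx Λ)
  refine ⟨eq_bot_iff.2 fun x hx => ?_,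
    (injective_iff_map_eq_zero _).2 fun x hx => key x fun Λ => ?_⟩
  · exact (TwoSidedIdeal.mem_bot _).2 (key x ((TwoSidedIdeal.mem_iInf _).1 hx))
  · have h : QuiverHecke.proj K n β Λ x = 0 := congrFun (congrArg Subtype.val hx) Λ
    rw [TwoSidedIdeal.mem_iff]
    exact (RingCon.eq _).1 h
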